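/- Let $\Omega\subset\mathbb R^N$ be an open set, $T>0$, $Q=\Omega\times(0,T)$, and let $p:\Omega\to[1,\infty]$ be measurable with $1<p^-:=\operatorname{ess\,inf}_\Omega p\le p^+:=\operatorname{ess\,sup}_\Omega p<\infty$. Set $p'(x)=p(x)/(p(x)-1)$. For $\mathcal O=\Omega$ or $\mathcal O=Q$ (with $p(x,t)=p(x)$ on $Q$), let $L^{p(x)}(\mathcal O)$ be the space of (classes of) measurable functions $u:\mathcal O\to\mathbb R$ with $\int_{\mathcal O}|u|^{p(x)}<\infty$, with the Luxemburg norm $\|u\|=\inf\{\lambda>0:\int_{\mathcal O}|u/\lambda|^{p(x)}\le1\}$; its dual is identified with $L^{p'(x)}(\mathcal O)$ through $\langle\xi,u\rangle=\int_{\mathcal O}\xi u$. Write $V=L^{p(x)}(\Omega)$, $V^*=L^{p'(x)}(\Omega)$, $\mathcal V=L^{p(x)}(Q)$, $\mathcal V^*=L^{p'(x)}(Q)$, and $Pu(t):=u(\cdot,t)$ for a.e. $t\in(0,T)$; then $Pu(t)\in V$ for a.e. $t$ if $u\in\mathcal V$, and $P\xi(t)\in V^*$ for a.e. $t$ if $\xi\in\mathcal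 V^*$. Let $\varphi:V\to[0,\infty]$ be convex, lower semicontinuous and proper (i.e. $\varphi\not\equiv\infty$), and define $\Phi:\mathcal V\to[0,\infty]$ by $\Phi(u)=\int_0^T\varphi(Pu(t))\,dt$ if $t\mapsto\varphi(Pu(t))$ belongs to $L^1(0,T)$, and $\Phi(u)=\infty$ otherwise. For $v\in V$ let $$\partial_\Omega\varphi(v)=\{\eta\in V^*:\ \varphi(v)<\infty\ \text{and}\ \varphi(w)-\varphi(v)\ge\langle\eta,w-v\rangle\ \text{for all } w\in V \text{ with }\varphi(w)<\infty\},$$ and define $\partial_Q\Phi(u)\subset\mathcal V^*$ for $u\in\mathcal V$ in the same way with $\mathcal V$, $\mathcal V^*$, $\Phi$ in place of $V$, $V^*$, $\varphi$. Then for all $u\in\mathcal V$ and $\xi\in\mathcal V^*$, $$\xi\in\partial_Q\Phi(u)\quad\Longleftrightarrow\quad P\xi(t)\in\partial_\Omega\varphi(Pu(t))\ \text{ for a.e. } t\in(0,T).$$ -/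

import Mathlib

open MeasureTheory Set
open scoped ENNReal NNReal

noncomputable section

/-- A variable exponent on the measure space `(α, μ)`: a measurable function `p` with values in
`[0, ∞]` such that `1 < p⁻ := ess inf p` and `p⁺ := ess sup p < ∞`. -/
structure VarExponent {α : Type*} [MeasurableSpace α] (μ : Measure α) where
  toFun : α → ℝ≥0∞
  aemeasurable : AEMeasurable toFun μ
  one_lt_essInf : 1 < essInf toFun μ
  essSup_lt_top : essSup toFun μ < ∞

namespace VarExponent

variable {α β : Type*} [MeasurableSpace α] [MeasurableSpace β] {μ : Measure α}

/-- The value `p(x)` as a real number; it is genuine for almost every `x`, since `p⁺ < ∞`. -/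
def val (p : VarExponent μ) (x : α) : ℝ := (p.toFun x).toReal

/-- The pointwise conjugate exponent `p'`, `1 / p(x) + 1 / p'(x) = 1`. -/
def conj (p : VarExponent μ) : VarExponent μ where
  toFun x := ENNReal.conjExponent (p.toFun x)
  aemeasurable := by
    have h := p.aemeasurable
    unfold ENNReal.conjExponent
    fun_prop
  one_lt_essInf := by
    refine lt_of_lt_of_le (b := 1 + (essSup p.toFun μ - 1)⁻¹) ?_ (le_essInf_of_ae_le _ ?_)
    · refine ENNReal.lt_add_right ENNReal.one_ne_top ?_
      exact ENNReal.inv_ne_zero.2 (ne_top_of_le_ne_top p.essSup_lt_top.ne tsub_le_self)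
    · filter_upwards [ENNReal.ae_le_essSup (μ := μ) p.toFun] with x hx
      unfold ENNReal.conjExponent
      gcongr
  essSup_lt_top := by
    refine lt_of_le_of_lt (essSup_le_of_ae_le (1 + (essInf p.toFun μ - 1)⁻¹) ?_) ?_
    · filter_upwards [ae_essInf_le (μ := μ) (f := p.toFun)] with x hx
      unfold ENNReal.conjExponent
      gcongr
    · refine ENNReal.add_lt_top.2 ⟨ENNReal.one_lt_top, ?_⟩
      exact ENNReal.inv_lt_top.2 (tsub_pos_of_lt p.one_lt_essInf)

/-- The exponent `(x, t) ↦ p(x)` on the product of `(α, μ)` with a time set `(β, ν)`. -/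
def onProd (p : VarExponent μ) (ν : Measure β) [SFinite ν] : VarExponent (μ.prod ν) where
  toFun z := p.toFun z.1
  aemeasurable := p.aemeasurable.comp_quasiMeasurePreserving
    Measure.quasiMeasurePreserving_fst
  one_lt_essInf := by
    refine lt_of_lt_of_le p.one_lt_essInf (le_essInf_of_ae_le _ ?_)
    exact Measure.quasiMeasurePreserving_fst.ae (ae_essInf_le (μ := μ) (f := p.toFun))
  essSup_lt_top := by
    refine lt_of_le_of_lt (essSup_le_of_ae_le (essSup p.toFun μ) ?_) p.essSup_lt_top
    exact Measure.quasiMeasurePreserving_fst.ae (ENNReal.ae_le_essSup (μ := μ) p.toFun)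

/-- The conjugate of `(x, t) ↦ p(x)` is `(x, t) ↦ p'(x)`. -/
lemma conj_onProd (p : VarExponent μ) (ν : Measure β) [SFinite ν] :
    (p.onProd ν).conj = p.conj.onProd ν := rfl

lemma ae_one_lt (p : VarExponent μ) : ∀ᵐ x ∂μ, 1 < p.val x := by
  filter_upwards [ae_lt_of_lt_essInf p.one_lt_essInf, ae_lt_of_essSup_lt p.essSup_lt_top]
    with x h1 h2
  have := (ENNReal.toReal_lt_toReal ENNReal.one_ne_top h2.ne).2 h1
  simpa [val] using this

lemma exists_ae_le (p : VarExponent μ) : ∃ b : ℝ, ∀ᵐ x ∂μ, p.val x ≤ b := by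
  refine ⟨(essSup p.toFun μ).toReal, ?_⟩
  filter_upwards [ENNReal.ae_le_essSup (μ := μ) p.toFun] with x hx
  exact ENNReal.toReal_mono p.essSup_lt_top.ne hx

/-- The modular `∫ |f(x)|^p(x) dμ(x)`, with values in `[0, ∞]`. -/
def modular (p : VarExponent μ) (f : α → ℝ) : ℝ≥0∞ :=
  ∫⁻ x, ‖f x‖ₑ ^ p.val x ∂μ

lemma modular_congr (p : VarExponent μ) {f g : α → ℝ} (h : f =ᵐ[μ] g) :
    p.modular f = p.modular g :=
  lintegral_congr_ae (by filter_upwards [h] with x hx; rw [hx])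

lemma modular_mono (p : VarExponent μ) {f g : α → ℝ} (h : ∀ᵐ x ∂μ, ‖f x‖ₑ ≤ ‖g x‖ₑ) :
    p.modular f ≤ p.modular g := by
  refine lintegral_mono_ae ?_
  filter_upwards [h, p.ae_one_lt] with x hx h1
  exact ENNReal.rpow_le_rpow hx (by linarith)

lemma modular_const_mul_lt_top (p : VarExponent μ) {f : α → ℝ} (hf : p.modular f < ∞) (c : ℝ) :
    p.modular (fun x => c * f x) < ∞ := by
  obtain ⟨b, hb⟩ := p.exists_ae_le
  set C : ℝ≥0∞ := max 1 ‖c‖ₑ with hC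
  have hCt : C ≠ ∞ := by simp [hC]
  have h : p.modular (fun x => c * f x) ≤ ∫⁻ x, C ^ b * ‖f x‖ₑ ^ p.val x ∂μ := by
    refine lintegral_mono_ae ?_
    filter_upwards [hb, p.ae_one_lt] with x hx h1
    rw [enorm_mul, ENNReal.mul_rpow_of_nonneg _ _ (by linarith)]
    gcongr
    calc ‖c‖ₑ ^ p.val x ≤ C ^ p.val x :=
          ENNReal.rpow_le_rpow (le_max_right _ _) (by linarith)
      _ ≤ C ^ b := ENNReal.rpow_le_rpow_of_exponent_le (le_max_left _ _) hx
  refine h.trans_lt ?_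
  by_cases h0 : C ^ b = ∞
  · have hne : C ≠ 0 := (lt_of_lt_of_le one_pos (le_max_left _ _)).ne'
    simp [ENNReal.rpow_eq_top_iff, hne, hCt] at h0
  · rw [lintegral_const_mul' _ _ h0]
    exact ENNReal.mul_lt_top (lt_top_iff_ne_top.2 h0) hf

lemma modular_convex (p : VarExponent μ) {f g : α → ℝ} (hf : AEMeasurable f μ)
    {a b : ℝ} (ha : 0 ≤ a) (hb : 0 ≤ b) (hab : a + b = 1) :
    p.modular (fun x => a * f x + b * g x) ≤
      ENNReal.ofReal a * p.modular f + ENNReal.ofReal b * p.modular g := by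
  have hp : AEMeasurable p.val μ := p.aemeasurable.ennreal_toReal
  have hm : AEMeasurable (fun x => ENNReal.ofReal a * ‖f x‖ₑ ^ p.val x) μ := by fun_prop
  rw [modular, modular, modular, ← lintegral_const_mul' _ _ ENNReal.ofReal_ne_top,
    ← lintegral_const_mul' _ _ ENNReal.ofReal_ne_top, ← lintegral_add_left' hm]
  refine lintegral_mono_ae ?_
  filter_upwards [p.ae_one_lt] with x h1
  have h := ENNReal.rpow_arith_mean_le_arith_mean2_rpow (ENNReal.ofReal a) (ENNReal.ofReal b)
    ‖f x‖ₑ ‖g x‖ₑ (by rw [← ENNReal.ofReal_add ha hb, hab, ENNReal.ofReal_one]) h1.le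
  refine le_trans (ENNReal.rpow_le_rpow ?_ (by linarith)) h
  refine (enorm_add_le _ _).trans_eq ?_
  rw [enorm_mul, enorm_mul, Real.enorm_of_nonneg ha, Real.enorm_of_nonneg hb]

end VarExponent

/-- The variable exponent Lebesgue space `L^{p(x)}(α, μ)`: the real vector space of (classes modulo
almost everywhere equality of) measurable functions `u` with `∫ |u|^p(x) dμ < ∞`. -/
def VarLp {α : Type*} [MeasurableSpace α] {μ : Measure α} (p : VarExponent μ) :
    Submodule ℝ (α →ₘ[μ] ℝ) where
  carrier := {u | p.modular u < ∞}
  zero_mem' := by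
    have h : p.modular (0 : α →ₘ[μ] ℝ) = ∫⁻ _, 0 ∂μ := by
      refine lintegral_congr_ae ?_
      filter_upwards [AEEqFun.coeFn_zero (α := α) (β := ℝ) (μ := μ), p.ae_one_lt] with x hx h1
      rw [hx]
      simp [ENNReal.zero_rpow_of_pos (show 0 < p.val x by linarith)]
    simp [h]
  add_mem' := by
    intro u v hu hv
    have h := p.modular_convex (f := fun x => 2 * u x) (g := fun x => 2 * v x)
      (a := 1 / 2) (b := 1 / 2) (by have := u.aemeasurable; fun_prop)
      (by norm_num) (by norm_num) (by norm_num)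
    have e : p.modular (u + v : α →ₘ[μ] ℝ) =
        p.modular (fun x => 1 / 2 * (2 * u x) + 1 / 2 * (2 * v x)) := by
      refine p.modular_congr ?_
      filter_upwards [AEEqFun.coeFn_add u v] with x hx
      rw [hx, Pi.add_apply]
      ring
    rw [mem_ofPred_eq, e]
    refine h.trans_lt (ENNReal.add_lt_top.2 ⟨?_, ?_⟩)
    · exact ENNReal.mul_lt_top ENNReal.ofReal_lt_top (p.modular_const_mul_lt_top hu 2)
    · exact ENNReal.mul_lt_top ENNReal.ofReal_lt_top (p.modular_const_mul_lt_top hv 2)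
  smul_mem' := by
    intro c u hu
    have e : p.modular (c • u : α →ₘ[μ] ℝ) = p.modular (fun x => c * u x) :=
      p.modular_congr (AEEqFun.coeFn_smul c u)
    rw [mem_ofPred_eq, e]
    exact p.modular_const_mul_lt_top hu c

namespace VarLp

variable {α β : Type*} [MeasurableSpace α] [MeasurableSpace β] {μ : Measure α}
  {p : VarExponent μ}

lemma mem_iff {u : α →ₘ[μ] ℝ} : u ∈ VarLp p ↔ p.modular u < ∞ := Iff.rfl

/-- The set of `l > 0` with `∫ |u(x) / l|^p(x) dμ ≤ 1`. -/
def luxemburgSet (u : VarLp p) : Set ℝ :=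
  {l : ℝ | 0 < l ∧ p.modular (fun x => (u : α →ₘ[μ] ℝ) x / l) ≤ 1}

/-- The Luxemburg norm `‖u‖ = inf {l > 0 : ∫ |u(x) / l|^p(x) dμ ≤ 1}`. -/
instance : Norm (VarLp p) where
  norm u := sInf (luxemburgSet u)

lemma norm_def (u : VarLp p) : ‖u‖ = sInf (luxemburgSet u) := rfl

lemma modular_div_le {f : α → ℝ} {l : ℝ} (hl : 1 ≤ l) :
    p.modular (fun x => f x / l) ≤ ENNReal.ofReal l⁻¹ * p.modular f := by
  rw [VarExponent.modular, VarExponent.modular,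
    ← lintegral_const_mul' _ _ ENNReal.ofReal_ne_top]
  refine lintegral_mono_ae ?_
  filter_upwards [p.ae_one_lt] with x h1
  have hl0 : 0 ≤ l⁻¹ := by positivity
  rw [div_eq_inv_mul, enorm_mul, Real.enorm_of_nonneg hl0,
    ENNReal.mul_rpow_of_nonneg _ _ (by linarith)]
  gcongr
  have hle : ENNReal.ofReal l⁻¹ ≤ 1 := by
    rw [← ENNReal.ofReal_one]
    exact ENNReal.ofReal_le_ofReal (inv_le_one_of_one_le₀ hl)
  simpa using ENNReal.rpow_le_rpow_of_exponent_ge hle h1.le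

lemma luxemburgSet_nonempty (u : VarLp p) : (luxemburgSet u).Nonempty := by
  have hu : p.modular (u : α →ₘ[μ] ℝ) < ∞ := u.2
  set r := (p.modular (u : α →ₘ[μ] ℝ)).toReal with hr
  have hl : 1 ≤ max 1 r := le_max_left _ _
  have hl0 : 0 < max 1 r := by linarith
  refine ⟨max 1 r, hl0, (modular_div_le hl).trans ?_⟩
  rw [← ENNReal.ofReal_toReal hu.ne, ← ENNReal.ofReal_mul (by positivity), ← hr,
    ← ENNReal.ofReal_one]
  refine ENNReal.ofReal_le_ofReal ?_
  rw [inv_mul_le_iff₀ hl0, mul_one]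
  exact le_max_right _ _

lemma luxemburgSet_bddBelow (u : VarLp p) : BddBelow (luxemburgSet u) :=
  ⟨0, fun _ h => h.1.le⟩

lemma luxemburgSet_upward {u : VarLp p} {l k : ℝ} (hl : l ∈ luxemburgSet u) (h : l ≤ k) :
    k ∈ luxemburgSet u := by
  refine ⟨hl.1.trans_le h, (p.modular_mono (.of_forall fun x => ?_)).trans hl.2⟩
  rw [enorm_le_iff_norm_le, norm_div, norm_div, Real.norm_of_nonneg hl.1.le,
    Real.norm_of_nonneg (hl.1.le.trans h)]
  exact div_le_div_of_nonneg_left (norm_nonneg _) hl.1 h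

lemma norm_nonneg' (u : VarLp p) : 0 ≤ ‖u‖ :=
  Real.sInf_nonneg fun _ h => h.1.le

lemma norm_add_le' (u v : VarLp p) : ‖u + v‖ ≤ ‖u‖ + ‖v‖ := by
  refine le_of_forall_pos_lt_add fun ε hε => ?_
  obtain ⟨l, hl, hlu⟩ := exists_lt_of_csInf_lt (luxemburgSet_nonempty u)
    (show sInf (luxemburgSet u) < ‖u‖ + ε / 2 by rw [← norm_def]; linarith)
  obtain ⟨k, hk, hkv⟩ := exists_lt_of_csInf_lt (luxemburgSet_nonempty v)
    (show sInf (luxemburgSet v) < ‖v‖ + ε / 2 by rw [← norm_def]; linarith)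
  have hl0 := hl.1
  have hk0 := hk.1
  have hlk : 0 < l + k := by linarith
  have key : l + k ∈ luxemburgSet (u + v) := by
    refine ⟨hlk, ?_⟩
    have e : p.modular (fun x => ((u + v : VarLp p) : α →ₘ[μ] ℝ) x / (l + k)) =
        p.modular (fun x => l / (l + k) * ((u : α →ₘ[μ] ℝ) x / l) +
          k / (l + k) * ((v : α →ₘ[μ] ℝ) x / k)) := by
      refine p.modular_congr ?_
      filter_upwards [AEEqFun.coeFn_add (u : α →ₘ[μ] ℝ) (v : α →ₘ[μ] ℝ)] with x hx
      rw [Submodule.coe_add, hx, Pi.add_apply]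
      field_simp
    rw [e]
    refine (p.modular_convex (by have := (u : α →ₘ[μ] ℝ).aemeasurable; fun_prop)
      (by positivity) (by positivity) (by field_simp)).trans ?_
    calc _ ≤ ENNReal.ofReal (l / (l + k)) * 1 + ENNReal.ofReal (k / (l + k)) * 1 := by
          gcongr
          exacts [hl.2, hk.2]
      _ = 1 := by
          rw [mul_one, mul_one, ← ENNReal.ofReal_add (by positivity) (by positivity),
            ← add_div, div_self hlk.ne', ENNReal.ofReal_one]
  have := csInf_le (luxemburgSet_bddBelow _) key
  rw [norm_def]
  linarith

lemma norm_smul_le' (c : ℝ) (u : VarLp p) (hc : c ≠ 0) : ‖c • u‖ ≤ |c| * ‖u‖ := by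
  have hc0 : 0 < |c| := abs_pos.2 hc
  rw [← div_le_iff₀' hc0]
  refine le_csInf (luxemburgSet_nonempty u) fun l hl => ?_
  rw [div_le_iff₀' hc0]
  refine csInf_le (luxemburgSet_bddBelow _) ⟨mul_pos hc0 hl.1, le_of_eq_of_le ?_ hl.2⟩
  refine le_antisymm (p.modular_mono ?_) (p.modular_mono ?_) <;>
  · filter_upwards [AEEqFun.coeFn_smul c (u : α →ₘ[μ] ℝ)] with x hx
    rw [Submodule.coe_smul, hx, Pi.smul_apply, smul_eq_mul, enorm_le_iff_norm_le]
    refine le_of_eq ?_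
    simp only [norm_div, norm_mul, Real.norm_eq_abs, abs_abs]
    field_simp

lemma norm_zero' : ‖(0 : VarLp p)‖ = 0 := by
  refine le_antisymm (le_of_forall_pos_le_add fun ε hε => ?_) (norm_nonneg' _)
  rw [zero_add]
  refine csInf_le (luxemburgSet_bddBelow _) ⟨hε, ?_⟩
  have h : p.modular (fun x => ((0 : VarLp p) : α →ₘ[μ] ℝ) x / ε) = ∫⁻ _, 0 ∂μ := by
    refine lintegral_congr_ae ?_
    filter_upwards [AEEqFun.coeFn_zero (α := α) (β := ℝ) (μ := μ), p.ae_one_lt] with x hx h1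
    rw [Submodule.coe_zero, hx]
    simp [ENNReal.zero_rpow_of_pos (show 0 < p.val x by linarith)]
  rw [h, lintegral_zero]
  exact zero_le_one

lemma norm_smul' (c : ℝ) (u : VarLp p) : ‖c • u‖ = |c| * ‖u‖ := by
  by_cases hc : c = 0
  · simp [hc, norm_zero']
  · refine le_antisymm (norm_smul_le' c u hc) ?_
    have h := norm_smul_le' c⁻¹ (c • u) (inv_ne_zero hc)
    rw [smul_smul, inv_mul_cancel₀ hc, one_smul, abs_inv] at h
    have hc0 : 0 < |c| := abs_pos.2 hc
    calc |c| * ‖u‖ ≤ |c| * (|c|⁻¹ * ‖c • u‖) := by gcongr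
      _ = ‖c • u‖ := by field_simp

lemma eq_zero_of_norm (u : VarLp p) (h : ‖u‖ = 0) : u = 0 := by
  have hmod : p.modular (u : α →ₘ[μ] ℝ) = 0 := by
    refine le_antisymm (le_of_forall_pos_le_add fun ε hε => ?_) bot_le
    rw [zero_add]
    by_cases hεt : ε = ∞
    · simp [hεt]
    set d := min 1 ε.toReal with hd
    have hd0 : 0 < d := lt_min one_pos (ENNReal.toReal_pos hε.ne' hεt)
    obtain ⟨l, hl, hlu⟩ := exists_lt_of_csInf_lt (luxemburgSet_nonempty u)
      (show sInf (luxemburgSet u) < d by rw [← norm_def, h]; exact hd0)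
    have hdm := luxemburgSet_upward hl hlu.le
    have h1 := modular_div_le (p := p) (f := fun x => (u : α →ₘ[μ] ℝ) x / d) (l := d⁻¹)
      ((one_le_inv₀ hd0).2 (min_le_left _ _))
    have e : (fun x => (u : α →ₘ[μ] ℝ) x / d / d⁻¹) = (u : α →ₘ[μ] ℝ) := by
      funext x
      field_simp
    rw [e, inv_inv] at h1
    calc p.modular (u : α →ₘ[μ] ℝ) ≤ ENNReal.ofReal d * 1 := h1.trans (by gcongr; exact hdm.2)
      _ ≤ ENNReal.ofReal ε.toReal := by
          rw [mul_one]
          exact ENNReal.ofReal_le_ofReal (min_le_right _ _)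
      _ = ε := ENNReal.ofReal_toReal hεt
  have hp : AEMeasurable p.val μ := p.aemeasurable.ennreal_toReal
  have hm := (u : α →ₘ[μ] ℝ).aemeasurable
  rw [VarExponent.modular, lintegral_eq_zero_iff' (by fun_prop)] at hmod
  refine Subtype.ext (AEEqFun.ext ?_)
  rw [Submodule.coe_zero]
  filter_upwards [hmod, p.ae_one_lt, AEEqFun.coeFn_zero (α := α) (β := ℝ) (μ := μ)]
    with x hx h1 h0
  rw [h0]
  have h2 : 0 < p.val x := by linarith
  simpa [ENNReal.rpow_eq_zero_iff, h2, h2.not_gt] using hx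

lemma normCore : NormedSpace.Core ℝ (VarLp p) where
  norm_nonneg := norm_nonneg'
  norm_smul c u := norm_smul' c u
  norm_triangle := norm_add_le'
  norm_eq_zero_iff u := ⟨eq_zero_of_norm u, fun h => h ▸ norm_zero'⟩

instance : NormedAddCommGroup (VarLp p) := NormedAddCommGroup.ofCore normCore

instance : NormedSpace ℝ (VarLp p) := NormedSpace.ofCore normCore

/-- The duality pairing `⟨ξ, u⟩ = ∫ ξ u dμ` of `ξ ∈ L^{p'(x)}` and `u ∈ L^{p(x)}`, by which
`L^{p'(x)}` is identified with the dual space of `L^{p(x)}`. -/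
def pairing (ξ : VarLp p.conj) (u : VarLp p) : ℝ :=
  ∫ x, (ξ : α →ₘ[μ] ℝ) x * (u : α →ₘ[μ] ℝ) x ∂μ

/-- The subdifferential, as a subset of `L^{p'(x)}`, of `F : L^{p(x)} → [0, ∞]` at `u`; it is empty
if `F u = ∞`. -/
def subdifferential (F : VarLp p → ℝ≥0∞) (u : VarLp p) : Set (VarLp p.conj) :=
  {ξ | F u ≠ ∞ ∧ ∀ v, F v ≠ ∞ → pairing ξ (v - u) ≤ (F v).toReal - (F u).toReal}

/-- The section `u(·, t)` of a class `u` of measurable functions of `(x, t)`. -/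
def slice {ν : Measure β} (u : α × β →ₘ[μ.prod ν] ℝ) (t : β) : α →ₘ[μ] ℝ :=
  AEEqFun.mk (fun x => u (x, t))
    (u.stronglyMeasurable.comp_measurable measurable_prodMk_right).aestronglyMeasurable

open Classical in
/-- Pointwise evaluation in time `P u(t) := u(·, t)`, an element of `L^{p(x)}` for almost every `t`
(on the exceptional null set it is given the value `0`). -/
def evalTime {ν : Measure β} [SFinite ν] (u : VarLp (p.onProd ν)) (t : β) : VarLp p :=
  if h : slice (u : α × β →ₘ[μ.prod ν] ℝ) t ∈ VarLp p then
    ⟨slice (u : α × β →ₘ[μ.prod ν] ℝ) t, h⟩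
  else 0

/-- For almost every `t`, the value `P u(t)` is the section `u(·, t)`. -/
lemma evalTime_ae {ν : Measure β} [SFinite μ] [SFinite ν] (u : VarLp (p.onProd ν)) :
    ∀ᵐ t ∂ν, ((evalTime u t : VarLp p) : α →ₘ[μ] ℝ) =ᵐ[μ]
      fun x => (u : α × β →ₘ[μ.prod ν] ℝ) (x, t) := by
  have hu : (p.onProd ν).modular (u : α × β →ₘ[μ.prod ν] ℝ) < ∞ := u.2
  have hp : AEMeasurable (p.onProd ν).val (μ.prod ν) := (p.onProd ν).aemeasurable.ennreal_toReal
  have hm := (u : α × β →ₘ[μ.prod ν] ℝ).aemeasurable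
  have hF : AEMeasurable (fun z => ‖(u : α × β →ₘ[μ.prod ν] ℝ) z‖ₑ ^ (p.onProd ν).val z)
    (μ.prod ν) := by fun_prop
  rw [VarExponent.modular, lintegral_prod_symm _ hF] at hu
  filter_upwards [ae_lt_top' hF.lintegral_prod_left' hu.ne] with t ht
  have hs : slice (u : α × β →ₘ[μ.prod ν] ℝ) t =ᵐ[μ]
      fun x => (u : α × β →ₘ[μ.prod ν] ℝ) (x, t) := AEEqFun.coeFn_mk _ _
  have hmem : slice (u : α × β →ₘ[μ.prod ν] ℝ) t ∈ VarLp p := by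
    rw [mem_iff, p.modular_congr hs]
    exact ht
  rw [evalTime, dif_pos hmem]
  exact hs

open Classical in
/-- The functional `Φ(u) = ∫ φ(P u(t)) dν(t)` if `t ↦ φ(P u(t))` is integrable (that is, measurable
with finite integral), and `Φ(u) = ∞` otherwise. -/
def timeIntegral (ν : Measure β) [SFinite ν] (φ : VarLp p → ℝ≥0∞) (u : VarLp (p.onProd ν)) :
    ℝ≥0∞ :=
  if AEMeasurable (fun t => φ (evalTime u t)) ν ∧ ∫⁻ t, φ (evalTime u t) ∂ν < ∞ then
    ∫⁻ t, φ (evalTime u t) ∂ν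
  else ∞

end VarLp

end

/-! By Fubini the pairing on the product is the time integral of the pairings of the sections, so
integrating the pointwise subgradient inequality gives the global one. Testing it at one fixed `v`
in the domain of `φ` also bounds `φ (evalTime u t)` by an integrable function, whence `Φ(u) < ∞`
(`mem_subdifferential_timeIntegral`).

Conversely, a competitor equal to `v` at times in `A` and to `u` elsewhere localises the global
inequality to `A`. As `A` is arbitrary, the inequality for this `v` holds at almost every time
(`ae_pairing_le_of_mem_subdifferential`). The null set depends on `v`; a countable family of `v`
whose points on the graph of `φ` are dense in the graph over the whole domain makes it uniform, by
continuity of the pairing.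

Both directions use separability of `L^{p(x)}`: one for measurability of `t ↦ φ (evalTime u t)`, the
other for the countable family. It is inherited from `L¹` through the Mazur map `f ↦ sign(f)
|f|^{1/p(x)}`, a continuous surjection. -/

/-! ### Conjugate exponents and Young's inequality -/

namespace VarExponent

variable {α : Type*} [MeasurableSpace α] {μ : Measure α}

lemma aemeasurable_val (p : VarExponent μ) : AEMeasurable p.val μ :=
  p.aemeasurable.ennreal_toReal

lemma ae_holderConjugate (p : VarExponent μ) :
    ∀ᵐ x ∂μ, (p.val x).HolderConjugate (p.conj.val x) := by
  filter_upwards [p.ae_one_lt, p.conj.ae_one_lt, ae_lt_of_lt_essInf p.one_lt_essInf,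
    ae_lt_of_essSup_lt p.essSup_lt_top, ae_lt_of_essSup_lt p.conj.essSup_lt_top]
    with x h1 h2 h3 h4 h5
  have : ENNReal.HolderConjugate (p.toFun x) (p.conj.toFun x) :=
    ENNReal.HolderConjugate.conjExponent h3.le
  exact ENNReal.HolderConjugate.toReal_of_ne_top h4.ne h5.ne

/-- Young's inequality for the modulars of conjugate exponents. -/
lemma lintegral_enorm_mul_le (p : VarExponent μ) {f g : α → ℝ} (hf : AEMeasurable f μ) :
    ∫⁻ x, ‖f x * g x‖ₑ ∂μ ≤ p.conj.modular f + p.modular g := by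
  have hp := p.conj.aemeasurable_val
  rw [modular, modular, ← lintegral_add_left' (by fun_prop)]
  refine lintegral_mono_ae ?_
  filter_upwards [p.ae_holderConjugate] with x h
  rw [enorm_mul]
  refine (ENNReal.young_inequality _ _ h.symm).trans (add_le_add ?_ ?_)
  · refine ENNReal.div_le_of_le_mul' (le_mul_of_one_le_left' ?_)
    simpa using h.symm.lt.le
  · refine ENNReal.div_le_of_le_mul' (le_mul_of_one_le_left' ?_)
    simpa using h.lt.le

end VarExponent

/-! ### Luxemburg norm, modular and continuity of the pairing -/

namespace VarLp

variable {α : Type*} [MeasurableSpace α] {μ : Measure α} {p : VarExponent μ}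

lemma norm_le_of_modular_div_le {u : VarLp p} {l : ℝ} (hl : 0 < l)
    (h : p.modular (fun x => (u : α →ₘ[μ] ℝ) x / l) ≤ 1) : ‖u‖ ≤ l :=
  csInf_le (luxemburgSet_bddBelow u) ⟨hl, h⟩

lemma modular_div_le_of_norm_lt {u : VarLp p} {l : ℝ} (h : ‖u‖ < l) :
    p.modular (fun x => (u : α →ₘ[μ] ℝ) x / l) ≤ 1 := by
  obtain ⟨k, hk, hkl⟩ := exists_lt_of_csInf_lt (luxemburgSet_nonempty u)
    (show sInf (luxemburgSet u) < l from h)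
  exact (luxemburgSet_upward hk hkl.le).2

/-- Restricting to rational scales expresses a norm bound through countably many modular conditions,
whose dependence on time is measurable by Tonelli. -/
lemma norm_lt_iff {u : VarLp p} {l : ℝ} :
    ‖u‖ < l ↔ ∃ q : ℚ, 0 < (q : ℝ) ∧ (q : ℝ) < l ∧
      p.modular (fun x => (u : α →ₘ[μ] ℝ) x / (q : ℝ)) ≤ 1 := by
  constructor
  · intro h
    obtain ⟨q, h1, h2⟩ := exists_rat_btwn h
    exact ⟨q, (norm_nonneg u).trans_lt h1, h2, modular_div_le_of_norm_lt h1⟩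
  · rintro ⟨q, h0, h1, h2⟩
    exact (norm_le_of_modular_div_le h0 h2).trans_lt h1

lemma integrable_mul (ξ : VarLp p.conj) (u : VarLp p) :
    Integrable (fun x => (ξ : α →ₘ[μ] ℝ) x * (u : α →ₘ[μ] ℝ) x) μ := by
  have hξ := (ξ : α →ₘ[μ] ℝ).aestronglyMeasurable
  have hu := (u : α →ₘ[μ] ℝ).aestronglyMeasurable
  exact ⟨hξ.mul hu, (p.lintegral_enorm_mul_le hξ.aemeasurable).trans_lt
    (ENNReal.add_lt_top.2 ⟨ξ.2, u.2⟩)⟩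

lemma pairing_sub (ξ : VarLp p.conj) (u v : VarLp p) :
    pairing ξ (u - v) = pairing ξ u - pairing ξ v := by
  rw [pairing, pairing, pairing, ← integral_sub (integrable_mul ξ u) (integrable_mul ξ v)]
  refine integral_congr_ae ?_
  filter_upwards [AEEqFun.coeFn_sub (u : α →ₘ[μ] ℝ) (v : α →ₘ[μ] ℝ)] with x hx
  rw [Submodule.coe_sub, hx, Pi.sub_apply, mul_sub]

/-- For `l > ‖u‖` the modular of `u / l` is at most `1`, so Young's inequality bounds the pairing of
`ξ` with `u / l`; then `l` decreases to `‖u‖`. The constant is crude, but continuity is all that is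
needed. -/
lemma abs_pairing_le (ξ : VarLp p.conj) (u : VarLp p) :
    |pairing ξ u| ≤ ((p.conj.modular (ξ : α →ₘ[μ] ℝ)).toReal + 1) * ‖u‖ := by
  set C := (p.conj.modular (ξ : α →ₘ[μ] ℝ)).toReal + 1 with hC
  have hC0 : 0 < C := by positivity
  have hξ : p.conj.modular (ξ : α →ₘ[μ] ℝ) < ∞ := ξ.2
  rw [← div_le_iff₀' hC0]
  refine le_of_forall_gt_imp_ge_of_dense fun l hl => ?_
  have hl0 : 0 < l := (norm_nonneg u).trans_lt hl
  rw [div_le_iff₀' hC0, ← div_le_iff₀ hl0]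
  have e : pairing ξ u / l = ∫ x, (ξ : α →ₘ[μ] ℝ) x * ((u : α →ₘ[μ] ℝ) x / l) ∂μ := by
    rw [pairing, ← integral_div]
    simp only [mul_div_assoc]
  have h := (p.lintegral_enorm_mul_le (g := fun x => (u : α →ₘ[μ] ℝ) x / l)
    (ξ : α →ₘ[μ] ℝ).aemeasurable).trans (add_le_add_right (modular_div_le_of_norm_lt hl) _)
  rw [← abs_of_pos hl0, ← abs_div, e, ← Real.norm_eq_abs, ← toReal_enorm]
  refine (ENNReal.toReal_mono (ENNReal.add_ne_top.2 ⟨hξ.ne, ENNReal.one_ne_top⟩)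
    ((enorm_integral_le_lintegral_enorm _).trans h)).trans_eq ?_
  rw [ENNReal.toReal_add hξ.ne ENNReal.one_ne_top, ENNReal.toReal_one]

lemma continuous_pairing (ξ : VarLp p.conj) : Continuous (pairing ξ) := by
  refine LipschitzWith.continuous (K := ⟨(p.conj.modular (ξ : α →ₘ[μ] ℝ)).toReal + 1,
    by positivity⟩) (LipschitzWith.of_dist_le_mul fun u v => ?_)
  rw [Real.dist_eq, ← pairing_sub, dist_eq_norm]
  exact abs_pairing_le ξ _

/-- Modular smallness forces norm smallness, since the exponent is bounded. -/
lemma exists_norm_le_of_modular_le (p : VarExponent μ) {ε : ℝ} (hε : 0 < ε) :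
    ∃ δ : ℝ≥0∞, 0 < δ ∧ ∀ u : VarLp p, p.modular (u : α →ₘ[μ] ℝ) ≤ δ → ‖u‖ ≤ ε := by
  obtain ⟨b, hb⟩ := p.exists_ae_le
  set d := min 1 ε with hd
  have hd0 : 0 < d := lt_min one_pos hε
  -- Since `d ≤ 1` and `p(x) ≤ b`, dividing by `d` multiplies the modular by at most `d ^ (-b)`.
  refine ⟨ENNReal.ofReal (d ^ b), by simp; positivity, fun u hu => ?_⟩
  refine (norm_le_of_modular_div_le hd0 ?_).trans (min_le_right _ _)
  calc p.modular (fun x => (u : α →ₘ[μ] ℝ) x / d)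
      ≤ ∫⁻ x, ENNReal.ofReal ((d ^ b)⁻¹) * ‖(u : α →ₘ[μ] ℝ) x‖ₑ ^ p.val x ∂μ := by
        refine lintegral_mono_ae ?_
        filter_upwards [hb, p.ae_one_lt] with x hx h1
        rw [div_eq_inv_mul, enorm_mul, ENNReal.mul_rpow_of_nonneg _ _ (by linarith),
          Real.enorm_of_nonneg (by positivity),
          ENNReal.ofReal_rpow_of_nonneg (by positivity) (by linarith)]
        gcongr
        rw [Real.inv_rpow hd0.le]
        refine inv_anti₀ (by positivity) ?_
        exact Real.rpow_le_rpow_of_exponent_ge hd0 (min_le_left _ _) hx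
    _ = ENNReal.ofReal ((d ^ b)⁻¹) * p.modular (u : α →ₘ[μ] ℝ) := by
        rw [lintegral_const_mul' _ _ ENNReal.ofReal_ne_top, VarExponent.modular]
    _ ≤ ENNReal.ofReal ((d ^ b)⁻¹) * ENNReal.ofReal (d ^ b) := by gcongr
    _ = 1 := by
        rw [← ENNReal.ofReal_mul (by positivity), inv_mul_cancel₀ (by positivity),
          ENNReal.ofReal_one]

/-- The class of an almost everywhere measurable function of finite modular. -/
noncomputable def ofFun (f : α → ℝ) (hf : AEMeasurable f μ) (h : p.modular f < ∞) : VarLp p :=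
  ⟨AEEqFun.mk f hf.aestronglyMeasurable, by
    rw [mem_iff, p.modular_congr (AEEqFun.coeFn_mk f hf.aestronglyMeasurable)]
    exact h⟩

lemma coeFn_ofFun {f : α → ℝ} (hf : AEMeasurable f μ) (h : p.modular f < ∞) :
    ((ofFun f hf h : VarLp p) : α →ₘ[μ] ℝ) =ᵐ[μ] f :=
  AEEqFun.coeFn_mk f hf.aestronglyMeasurable

/-! ### The Mazur map and separability -/

/-- The signed power `sign(s) |s| ^ a`. -/
noncomputable def signedPow (s a : ℝ) : ℝ := (max s 0) ^ a - (max (-s) 0) ^ a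

lemma signedPow_neg (s a : ℝ) : signedPow (-s) a = -signedPow s a := by
  simp [signedPow]

lemma signedPow_of_nonneg {s a : ℝ} (hs : 0 ≤ s) (ha : a ≠ 0) : signedPow s a = s ^ a := by
  simp [signedPow, hs, Real.zero_rpow ha]

lemma signedPow_signedPow_inv (s : ℝ) {a : ℝ} (ha : a ≠ 0) :
    signedPow (signedPow s a) a⁻¹ = s := by
  have key : ∀ s : ℝ, 0 ≤ s → signedPow (signedPow s a) a⁻¹ = s := fun s hs => by
    rw [signedPow_of_nonneg hs ha, signedPow_of_nonneg (by positivity) (inv_ne_zero ha),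
      Real.rpow_rpow_inv hs ha]
  rcases le_total 0 s with hs | hs
  · exact key s hs
  · have := key (-s) (by linarith)
    rwa [signedPow_neg, signedPow_neg, neg_inj] at this

lemma abs_signedPow (s : ℝ) {a : ℝ} (ha : a ≠ 0) : |signedPow s a| = |s| ^ a := by
  rcases le_total 0 s with hs | hs
  · rw [signedPow_of_nonneg hs ha, abs_of_nonneg (by positivity), abs_of_nonneg hs]
  · rw [← abs_neg, ← signedPow_neg, signedPow_of_nonneg (by linarith) ha, abs_of_nonpos hs,
      abs_of_nonneg (by apply Real.rpow_nonneg; linarith)]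

/-- Subadditivity of `s ↦ s ^ a` on the half-line for `a ≤ 1`. -/
lemma abs_rpow_sub_rpow_le {s t a : ℝ} (hs : 0 ≤ s) (ht : 0 ≤ t) (ha : 0 ≤ a) (ha1 : a ≤ 1) :
    |s ^ a - t ^ a| ≤ |s - t| ^ a := by
  have key : ∀ s t : ℝ, 0 ≤ t → t ≤ s → |s ^ a - t ^ a| ≤ |s - t| ^ a := fun s t ht hts => by
    rw [abs_of_nonneg (sub_nonneg.2 (Real.rpow_le_rpow ht hts ha)),
      abs_of_nonneg (sub_nonneg.2 hts)]
    have := Real.rpow_add_le_add_rpow (sub_nonneg.2 hts) ht ha ha1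
    rw [sub_add_cancel] at this
    linarith
  rcases le_total t s with h | h
  · exact key s t ht h
  · rw [abs_sub_comm, abs_sub_comm s]
    exact key t s hs h

/-- Positive and negative parts are 1-Lipschitz, and each contributes one `|s - t| ^ a`. -/
lemma abs_signedPow_sub_le (s t : ℝ) {a : ℝ} (ha : 0 ≤ a) (ha1 : a ≤ 1) :
    |signedPow s a - signedPow t a| ≤ 2 * |s - t| ^ a := by
  have h1 := (abs_rpow_sub_rpow_le (le_max_right s 0) (le_max_right t 0) ha ha1).trans
    (Real.rpow_le_rpow (abs_nonneg _) (abs_max_sub_max_le_abs s t 0) ha)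
  have h2 := (abs_rpow_sub_rpow_le (le_max_right (-s) 0) (le_max_right (-t) 0) ha ha1).trans
    (Real.rpow_le_rpow (abs_nonneg _) (abs_max_sub_max_le_abs (-s) (-t) 0) ha)
  rw [show -s - -t = -(s - t) by ring, abs_neg] at h2
  calc |signedPow s a - signedPow t a|
      = |(max s 0 ^ a - max t 0 ^ a) - (max (-s) 0 ^ a - max (-t) 0 ^ a)| := by
        rw [signedPow, signedPow]; ring_nf
    _ ≤ _ := (abs_sub _ _).trans (by linarith)

lemma aemeasurable_signedPow {f g : α → ℝ} (hf : AEMeasurable f μ) (hg : AEMeasurable g μ) :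
    AEMeasurable (fun x => signedPow (f x) (g x)) μ := by
  unfold signedPow
  fun_prop

lemma modular_signedPow_inv (p : VarExponent μ) (f : α → ℝ) :
    p.modular (fun x => signedPow (f x) (p.val x)⁻¹) = ∫⁻ x, ‖f x‖ₑ ∂μ := by
  refine lintegral_congr_ae ?_
  filter_upwards [p.ae_one_lt] with x h1
  have h0 : 0 < p.val x := by linarith
  rw [← Real.enorm_abs, abs_signedPow _ (by positivity), Real.enorm_of_nonneg (by positivity),
    ENNReal.ofReal_rpow_of_nonneg (by positivity) h0.le, Real.rpow_inv_rpow (abs_nonneg _) h0.ne',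
    ← Real.norm_eq_abs, ofReal_norm]

/-- The Mazur map from `L¹` to `L^{p(x)}`. -/
noncomputable def mazur (p : VarExponent μ) (f : Lp ℝ 1 μ) : VarLp p :=
  ofFun (fun x => signedPow (f x) (p.val x)⁻¹)
    (aemeasurable_signedPow (Lp.aestronglyMeasurable f).aemeasurable p.aemeasurable_val.inv)
    (by
      rw [modular_signedPow_inv]
      exact (L1.integrable_coeFn f).2)

lemma coeFn_mazur (p : VarExponent μ) (f : Lp ℝ 1 μ) :
    ((mazur p f : VarLp p) : α →ₘ[μ] ℝ) =ᵐ[μ] fun x => signedPow (f x) (p.val x)⁻¹ :=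
  coeFn_ofFun _ _

/-- The preimage of `u` is `sign(u) |u|^{p(x)}`, whose `L¹` norm is the modular of `u`. -/
lemma mazur_surjective (p : VarExponent μ) : Function.Surjective (mazur p) := by
  intro u
  have hu : p.modular (u : α →ₘ[μ] ℝ) < ∞ := u.2
  have hm := aemeasurable_signedPow (u : α →ₘ[μ] ℝ).aemeasurable p.aemeasurable_val
  have hi : Integrable (fun x => signedPow ((u : α →ₘ[μ] ℝ) x) (p.val x)) μ := by
    refine ⟨hm.aestronglyMeasurable, lt_of_le_of_lt (lintegral_mono_ae ?_) hu⟩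
    filter_upwards [p.ae_one_lt] with x h1
    have h0 : 0 < p.val x := by linarith
    rw [← Real.enorm_abs, abs_signedPow _ h0.ne', Real.enorm_of_nonneg (by positivity),
      ← ENNReal.ofReal_rpow_of_nonneg (by positivity) h0.le, ← Real.norm_eq_abs, ofReal_norm]
  refine ⟨hi.toL1 _, Subtype.ext (AEEqFun.ext ?_)⟩
  filter_upwards [coeFn_mazur p (hi.toL1 _), hi.coeFn_toL1, p.ae_one_lt] with x h1 h2 h3
  rw [h1, h2, signedPow_signedPow_inv _ (by linarith)]

/-- The power `p(x)` in the modular cancels the Hölder exponent `1 / p(x)` of the signed root,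
leaving `2 ^ p(x) ≤ 2 ^ b` as the factor. -/
lemma exists_modular_mazur_sub_le (p : VarExponent μ) :
    ∃ C : ℝ≥0, 0 < C ∧ ∀ f g : Lp ℝ 1 μ,
      p.modular ((mazur p f - mazur p g : VarLp p) : α →ₘ[μ] ℝ) ≤ C * edist f g := by
  obtain ⟨b, hb⟩ := p.exists_ae_le
  refine ⟨2 ^ b, by positivity, fun f g => ?_⟩
  rw [Lp.edist_def, eLpNorm_one_eq_lintegral_enorm, ← lintegral_const_mul' _ _ (by finiteness)]
  refine lintegral_mono_ae ?_
  filter_upwards [coeFn_mazur p f, coeFn_mazur p g, p.ae_one_lt, hb,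
    AEEqFun.coeFn_sub (mazur p f : α →ₘ[μ] ℝ) (mazur p g : α →ₘ[μ] ℝ)] with x h1 h2 h3 h4 h5
  have h0 : 0 < p.val x := by linarith
  rw [Submodule.coe_sub, h5, Pi.sub_apply, h1, h2, Pi.sub_apply, ← ofReal_norm, ← ofReal_norm,
    Real.norm_eq_abs, Real.norm_eq_abs, ENNReal.ofReal_rpow_of_nonneg (abs_nonneg _) h0.le,
    ← ENNReal.ofReal_coe_nnreal, ← ENNReal.ofReal_mul (by positivity)]
  refine ENNReal.ofReal_le_ofReal ?_
  calc _ ≤ (2 * |f x - g x| ^ (p.val x)⁻¹) ^ p.val x :=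
        Real.rpow_le_rpow (abs_nonneg _)
          (abs_signedPow_sub_le _ _ (by positivity) (inv_le_one_of_one_le₀ h3.le)) h0.le
    _ = 2 ^ p.val x * |f x - g x| := by
        rw [Real.mul_rpow (by norm_num) (by positivity),
          Real.rpow_inv_rpow (abs_nonneg _) h0.ne']
    _ ≤ _ := by
        rw [NNReal.coe_rpow, NNReal.coe_ofNat]
        exact mul_le_mul_of_nonneg_right
          (Real.rpow_le_rpow_of_exponent_le (by norm_num) h4) (abs_nonneg _)

lemma continuous_mazur (p : VarExponent μ) : Continuous (mazur p) := by
  obtain ⟨C, hC, h⟩ := exists_modular_mazur_sub_le p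
  refine Metric.continuous_iff'.2 fun f ε hε => ?_
  obtain ⟨δ, hδ, hε'⟩ := exists_norm_le_of_modular_le p (half_pos hε)
  have ht : Filter.Tendsto (fun g => C * edist g f) (nhds f) (nhds 0) := by
    have := ENNReal.Tendsto.const_mul (a := (C : ℝ≥0∞))
      ((continuous_id.edist (continuous_const (y := f))).tendsto f) (Or.inr ENNReal.coe_ne_top)
    simpa using this
  filter_upwards [ht.eventually_lt_const hδ] with g hg
  rw [dist_eq_norm]
  exact (hε' _ ((h g f).trans hg.le)).trans_lt (half_lt_self hε)

instance [IsSeparable μ] : TopologicalSpace.SeparableSpace (VarLp p) :=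
  have : Fact ((1 : ℝ≥0∞) ≠ ∞) := ⟨ENNReal.one_ne_top⟩
  (mazur_surjective p).denseRange.separableSpace (continuous_mazur p)

end VarLp
-- Sections in time and Fubini for the pairing
namespace VarLp

variable {α β : Type*} [MeasurableSpace α] [MeasurableSpace β] {μ : Measure α} {ν : Measure β}
  {p : VarExponent μ}

lemma aemeasurable_ite_mem {γ : Type*} [MeasurableSpace γ] {A : Set β} [DecidablePred (· ∈ A)]
    (hA : MeasurableSet A) {f g : β → γ} (hf : AEMeasurable f ν) (hg : AEMeasurable g ν) :
    AEMeasurable (fun t => if t ∈ A then f t else g t) ν := by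
  refine ⟨fun t => if t ∈ A then hf.mk f t else hg.mk g t,
    hf.measurable_mk.ite hA hg.measurable_mk, ?_⟩
  filter_upwards [hf.ae_eq_mk, hg.ae_eq_mk] with t h1 h2
  rw [h1, h2]

lemma ae_ae_of_ae_prod_swap [SFinite μ] [SFinite ν] {P : α × β → Prop}
    (h : ∀ᵐ z ∂μ.prod ν, P z) : ∀ᵐ t ∂ν, ∀ᵐ x ∂μ, P (x, t) :=
  Measure.ae_ae_of_ae_prod (Measure.measurePreserving_swap.quasiMeasurePreserving.ae h)

lemma evalTime_ae_eq [SFinite μ] [SFinite ν] {u : VarLp (p.onProd ν)} {f : α × β → ℝ}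
    (h : (u : α × β →ₘ[μ.prod ν] ℝ) =ᵐ[μ.prod ν] f) :
    ∀ᵐ t ∂ν, ((evalTime u t : VarLp p) : α →ₘ[μ] ℝ) =ᵐ[μ] fun x => f (x, t) := by
  filter_upwards [evalTime_ae u, ae_ae_of_ae_prod_swap h] with t h1 h2
  exact h1.trans h2

/-- Additivity can fail at exceptional times, where `evalTime` takes its default value `0`. -/
lemma evalTime_sub [SFinite μ] [SFinite ν] (u v : VarLp (p.onProd ν)) :
    ∀ᵐ t ∂ν, evalTime (u - v) t = evalTime u t - evalTime v t := by
  have h : ((u - v : VarLp (p.onProd ν)) : α × β →ₘ[μ.prod ν] ℝ) =ᵐ[μ.prod ν]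
      fun z => (u : α × β →ₘ[μ.prod ν] ℝ) z - (v : α × β →ₘ[μ.prod ν] ℝ) z :=
    AEEqFun.coeFn_sub _ _
  filter_upwards [evalTime_ae_eq h, evalTime_ae u, evalTime_ae v] with t h1 h2 h3
  refine Subtype.ext (AEEqFun.ext ?_)
  rw [Submodule.coe_sub]
  filter_upwards [h1, h2, h3, AEEqFun.coeFn_sub (evalTime u t : α →ₘ[μ] ℝ)
    (evalTime v t : α →ₘ[μ] ℝ)] with x h1 h2 h3 h4
  rw [h1, h4, Pi.sub_apply, h2, h3]

lemma pairing_evalTime_ae [SFinite μ] [SFinite ν] (ξ : VarLp (p.onProd ν).conj)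
    (u : VarLp (p.onProd ν)) :
    ∀ᵐ t ∂ν, pairing (evalTime (p := p.conj) ξ t) (evalTime u t) =
      ∫ x, (ξ : α × β →ₘ[μ.prod ν] ℝ) (x, t) * (u : α × β →ₘ[μ.prod ν] ℝ) (x, t) ∂μ := by
  filter_upwards [evalTime_ae (p := p.conj) ξ, evalTime_ae u] with t h1 h2
  refine integral_congr_ae ?_
  filter_upwards [h1, h2] with x h1 h2
  rw [h1, h2]

lemma integrable_pairing_evalTime [SFinite μ] [SFinite ν] (ξ : VarLp (p.onProd ν).conj)
    (u : VarLp (p.onProd ν)) :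
    Integrable (fun t => pairing (evalTime (p := p.conj) ξ t) (evalTime u t)) ν :=
  (integrable_mul ξ u).integral_prod_right.congr
    ((pairing_evalTime_ae ξ u).mono fun _ h => h.symm)

lemma integral_pairing_evalTime [SFinite μ] [SFinite ν] (ξ : VarLp (p.onProd ν).conj)
    (u : VarLp (p.onProd ν)) :
    ∫ t, pairing (evalTime (p := p.conj) ξ t) (evalTime u t) ∂ν = pairing ξ u := by
  rw [integral_congr_ae (pairing_evalTime_ae ξ u), pairing,
    integral_prod_symm _ (integrable_mul ξ u)]

/-! ### Competitors modified on a set of times -/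

section Splice

variable [IsFiniteMeasure ν]

/-- Finiteness of the time measure is what admits functions constant in time. -/
lemma modular_onProd_const (v : VarLp p) :
    (p.onProd ν).modular (fun z : α × β => (v : α →ₘ[μ] ℝ) z.1) < ∞ := by
  have hm : AEMeasurable (fun x => ‖(v : α →ₘ[μ] ℝ) x‖ₑ ^ p.val x) μ := by
    have := (v : α →ₘ[μ] ℝ).aemeasurable
    have := p.aemeasurable_val
    fun_prop
  have e : (p.onProd ν).modular (fun z : α × β => (v : α →ₘ[μ] ℝ) z.1) =
      p.modular (v : α →ₘ[μ] ℝ) * ν univ := by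
    have := lintegral_prod_mul (ν := ν) (g := fun _ => 1) hm aemeasurable_const
    simpa [VarExponent.modular] using! this
  rw [e]
  exact ENNReal.mul_lt_top v.2 (measure_lt_top ν _)

variable [SFinite μ]

open Classical in
lemma exists_splice (v : VarLp p) {A : Set β} (hA : MeasurableSet A) (u : VarLp (p.onProd ν)) :
    ∃ w : VarLp (p.onProd ν), ∀ᵐ t ∂ν, evalTime w t = if t ∈ A then v else evalTime u t := by
  have hm : AEMeasurable (fun z : α × β => if z ∈ Prod.snd ⁻¹' A then (v : α →ₘ[μ] ℝ) z.1
      else (u : α × β →ₘ[μ.prod ν] ℝ) z) (μ.prod ν) :=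
    aemeasurable_ite_mem (measurable_snd hA)
      ((v : α →ₘ[μ] ℝ).aemeasurable.comp_quasiMeasurePreserving Measure.quasiMeasurePreserving_fst)
      (u : α × β →ₘ[μ.prod ν] ℝ).aemeasurable
  have hfin : (p.onProd ν).modular (fun z : α × β => if z ∈ Prod.snd ⁻¹' A then
      (v : α →ₘ[μ] ℝ) z.1 else (u : α × β →ₘ[μ.prod ν] ℝ) z) < ∞ := by
    have hp := (p.onProd ν).aemeasurable_val
    have hu := (u : α × β →ₘ[μ.prod ν] ℝ).aemeasurable
    -- At each point the spliced integrand is one of the two given integrands, hence at most their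
    -- sum.
    refine lt_of_le_of_lt ?_ (ENNReal.add_lt_top.2 ⟨u.2, modular_onProd_const (ν := ν) v⟩)
    rw [VarExponent.modular, VarExponent.modular, VarExponent.modular,
      ← lintegral_add_left' (by fun_prop)]
    refine lintegral_mono fun z => ?_
    by_cases hz : z ∈ Prod.snd ⁻¹' A <;> simp only [hz, if_true, if_false]
    exacts [le_add_self, le_self_add]
  refine ⟨ofFun _ hm hfin, ?_⟩
  filter_upwards [evalTime_ae_eq (coeFn_ofFun hm hfin), evalTime_ae u] with t h1 h2
  refine Subtype.ext (AEEqFun.ext ?_)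
  filter_upwards [h1, h2] with x h1 h2
  rw [h1]
  by_cases ht : t ∈ A <;> simp [ht, h2]

lemma exists_evalTime_eq_const (v : VarLp p) :
    ∃ w : VarLp (p.onProd ν), ∀ᵐ t ∂ν, evalTime w t = v := by
  obtain ⟨w, hw⟩ := exists_splice (ν := ν) v MeasurableSet.univ 0
  exact ⟨w, by simpa using hw⟩

end Splice

/-! ### Measurability of `φ` along sections -/

section Measurability

variable [SFinite μ]

lemma aemeasurable_modular_evalTime_div [SFinite ν] (u : VarLp (p.onProd ν)) (q : ℝ) :
    AEMeasurable (fun t => p.modular (fun x => (evalTime u t : α →ₘ[μ] ℝ) x / q)) ν := by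
  have hp := (p.onProd ν).aemeasurable_val
  have hu := (u : α × β →ₘ[μ.prod ν] ℝ).aemeasurable
  have hF : AEMeasurable (fun z => ‖(u : α × β →ₘ[μ.prod ν] ℝ) z / q‖ₑ ^ (p.onProd ν).val z)
    (μ.prod ν) := by fun_prop
  refine hF.lintegral_prod_left'.congr ?_
  filter_upwards [evalTime_ae u] with t ht
  refine lintegral_congr_ae ?_
  filter_upwards [ht] with x hx
  rw [hx]
  rfl

lemma nullMeasurableSet_norm_evalTime_lt [SFinite ν] (u : VarLp (p.onProd ν)) (r : ℝ) :
    NullMeasurableSet {t | ‖(evalTime u t : VarLp p)‖ < r} ν := by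
  have e : {t | ‖(evalTime u t : VarLp p)‖ < r} = ⋃ q : {q : ℚ // 0 < (q : ℝ) ∧ (q : ℝ) < r},
      {t | p.modular (fun x => (evalTime u t : α →ₘ[μ] ℝ) x / (q : ℚ)) ≤ 1} := by
    ext t
    simp [norm_lt_iff, and_assoc]
  rw [e]
  exact .iUnion fun q => nullMeasurableSet_le (aemeasurable_modular_evalTime_div u _)
    aemeasurable_const

variable [IsFiniteMeasure ν]

/-- Extending the centre `v` constantly in time reduces to balls around zero. -/
lemma nullMeasurableSet_evalTime_mem_ball (u : VarLp (p.onProd ν)) (v : VarLp p) (r : ℝ) :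
    NullMeasurableSet {t | evalTime u t ∈ Metric.ball v r} ν := by
  obtain ⟨w, hw⟩ := exists_evalTime_eq_const (ν := ν) v
  refine (nullMeasurableSet_norm_evalTime_lt (u - w) r).congr ?_
  filter_upwards [hw, evalTime_sub u w] with t h1 h2
  refine propext ?_
  change ‖(evalTime (u - w) t : VarLp p)‖ < r ↔ evalTime u t ∈ Metric.ball v r
  rw [h2, h1, mem_ball_iff_norm]

variable [TopologicalSpace.SeparableSpace (VarLp p)]

/-- By separability an open set is a countable union of balls. -/
lemma nullMeasurableSet_evalTime_mem_of_isOpen (u : VarLp (p.onProd ν)) {U : Set (VarLp p)}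
    (hU : IsOpen U) : NullMeasurableSet {t | evalTime u t ∈ U} ν := by
  have : SecondCountableTopology (VarLp p) := UniformSpace.secondCountable_of_separable _
  have h : ∀ v ∈ U, ∃ r > 0, Metric.ball v r ⊆ U := fun v hv => Metric.isOpen_iff.1 hU v hv
  choose! r hr hrU using h
  obtain ⟨S, hSU, hS, hcov⟩ := TopologicalSpace.countable_cover_nhdsWithin
    (s := U) (f := fun v => Metric.ball v (r v))
    fun v hv => mem_nhdsWithin_of_mem_nhds (Metric.ball_mem_nhds v (hr v hv))
  have e : {t | evalTime u t ∈ U} = ⋃ v ∈ S, {t | evalTime u t ∈ Metric.ball v (r v)} := by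
    ext t
    simp only [mem_iUnion, mem_ofPred_eq]
    constructor
    · intro ht
      simpa using hcov ht
    · rintro ⟨v, hv, ht⟩
      exact hrU v (hSU hv) ht
  rw [e]
  exact .biUnion hS fun v _ => nullMeasurableSet_evalTime_mem_ball u v _

/-- Lower semicontinuity makes the superlevel sets `{φ > c}` open, and these suffice for
measurability. -/
lemma aemeasurable_comp_evalTime {φ : VarLp p → ℝ≥0∞} (hφ : LowerSemicontinuous φ)
    (u : VarLp (p.onProd ν)) : AEMeasurable (fun t => φ (evalTime u t)) ν := by
  have h : NullMeasurable (fun t => φ (evalTime u t)) ν :=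
    measurable_of_Ioi (α := ℝ≥0∞) (δ := NullMeasurableSpace β ν)
      fun c => nullMeasurableSet_evalTime_mem_of_isOpen u (hφ.isOpen_preimage c)
  exact h.aemeasurable

end Measurability

/-! ### Pointwise and integrated subgradients -/

section Subdifferential

variable {φ : VarLp p → ℝ≥0∞}

lemma timeIntegral_ne_top_iff [SFinite ν] {u : VarLp (p.onProd ν)} :
    timeIntegral ν φ u ≠ ∞ ↔ AEMeasurable (fun t => φ (evalTime u t)) ν ∧
      ∫⁻ t, φ (evalTime u t) ∂ν ≠ ∞ := by
  rw [timeIntegral]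
  split_ifs with h
  · exact ⟨fun _ => ⟨h.1, h.2.ne⟩, fun _ => h.2.ne⟩
  · simp only [ne_eq, not_true, false_iff]
    exact fun h' => h ⟨h'.1, lt_top_iff_ne_top.2 h'.2⟩

lemma ae_ne_top_of_timeIntegral_ne_top [SFinite ν] {u : VarLp (p.onProd ν)}
    (h : timeIntegral ν φ u ≠ ∞) : ∀ᵐ t ∂ν, φ (evalTime u t) ≠ ∞ := by
  rw [timeIntegral_ne_top_iff] at h
  filter_upwards [ae_lt_top' h.1 h.2] with t ht using ht.ne

lemma integrable_toReal_of_timeIntegral_ne_top [SFinite ν] {u : VarLp (p.onProd ν)}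
    (h : timeIntegral ν φ u ≠ ∞) : Integrable (fun t => (φ (evalTime u t)).toReal) ν := by
  rw [timeIntegral_ne_top_iff] at h
  exact integrable_toReal_of_lintegral_ne_top h.1 h.2

lemma toReal_timeIntegral [SFinite ν] {u : VarLp (p.onProd ν)}
    (h : timeIntegral ν φ u ≠ ∞) :
    (timeIntegral ν φ u).toReal = ∫ t, (φ (evalTime u t)).toReal ∂ν := by
  have h' := timeIntegral_ne_top_iff.1 h
  rw [integral_toReal h'.1 (ae_lt_top' h'.1 h'.2), timeIntegral, if_pos ⟨h'.1, h'.2.lt_top⟩]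

variable [SFinite μ] [IsFiniteMeasure ν]

/-- Pointwise subgradients form a subgradient of the time integral. -/
lemma mem_subdifferential_timeIntegral [TopologicalSpace.SeparableSpace (VarLp p)]
    (hproper : ∃ v, φ v ≠ ∞) (hlsc : LowerSemicontinuous φ)
    {u : VarLp (p.onProd ν)} {ξ : VarLp (p.onProd ν).conj}
    (h : ∀ᵐ t ∂ν, evalTime (p := p.conj) ξ t ∈ subdifferential φ (evalTime u t)) :
    ξ ∈ subdifferential (timeIntegral ν φ) u := by
  have hint := integrable_pairing_evalTime ξ u
  have hu : timeIntegral ν φ u ≠ ∞ := by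
    refine timeIntegral_ne_top_iff.2 ⟨aemeasurable_comp_evalTime hlsc u, ?_⟩
    obtain ⟨v, hv⟩ := hproper
    obtain ⟨w, hw⟩ := exists_evalTime_eq_const (ν := ν) v
    -- This is the upper bound for `φ (evalTime u t)` that the subgradient inequality gives when
    -- tested at `v`.
    have hi : Integrable (fun t => (φ v).toReal -
        (pairing (evalTime (p := p.conj) ξ t) (evalTime w t) -
          pairing (evalTime (p := p.conj) ξ t) (evalTime u t))) ν :=
      (integrable_const _).sub ((integrable_pairing_evalTime ξ w).sub hint)
    refine ne_top_of_le_ne_top hi.2.ne (lintegral_mono_ae ?_)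
    filter_upwards [h, hw] with t ⟨h1, h2⟩ h3
    have := h2 v hv
    rw [pairing_sub] at this
    rw [h3, ← ENNReal.ofReal_toReal h1, Real.enorm_eq_ofReal_abs]
    exact ENNReal.ofReal_le_ofReal ((by linarith : _ ≤ _).trans (le_abs_self _))
  refine ⟨hu, fun w hw => ?_⟩
  rw [pairing_sub, ← integral_pairing_evalTime, ← integral_pairing_evalTime,
    toReal_timeIntegral hu, toReal_timeIntegral hw,
    ← integral_sub (integrable_pairing_evalTime ξ w) hint,
    ← integral_sub (integrable_toReal_of_timeIntegral_ne_top hw)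
      (integrable_toReal_of_timeIntegral_ne_top hu)]
  refine integral_mono_ae ((integrable_pairing_evalTime ξ w).sub hint)
    ((integrable_toReal_of_timeIntegral_ne_top hw).sub
      (integrable_toReal_of_timeIntegral_ne_top hu)) ?_
  filter_upwards [h, ae_ne_top_of_timeIntegral_ne_top hw] with t ⟨_, h2⟩ h3
  rw [← pairing_sub]
  exact h2 _ h3

/-- Testing a subgradient of the time integral against splices of a fixed `v`. -/
lemma ae_pairing_le_of_mem_subdifferential {u : VarLp (p.onProd ν)}
    {ξ : VarLp (p.onProd ν).conj} (h : ξ ∈ subdifferential (timeIntegral ν φ) u)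
    {v : VarLp p} (hv : φ v ≠ ∞) :
    ∀ᵐ t ∂ν, pairing (evalTime (p := p.conj) ξ t) (v - evalTime u t) ≤
      (φ v).toReal - (φ (evalTime u t)).toReal := by
  obtain ⟨hu, h⟩ := h
  have hu' := timeIntegral_ne_top_iff.1 hu
  have hIu := integrable_toReal_of_timeIntegral_ne_top hu
  obtain ⟨c, hc⟩ := exists_evalTime_eq_const (ν := ν) v
  have hpair : Integrable (fun t => pairing (evalTime (p := p.conj) ξ t) (v - evalTime u t)) ν := by
    refine ((integrable_pairing_evalTime ξ c).sub (integrable_pairing_evalTime ξ u)).congr ?_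
    filter_upwards [hc] with t ht
    rw [pairing_sub, ← ht]
    rfl
  have hg := ((integrable_const (μ := ν) (φ v).toReal).sub hIu).sub hpair
  have hnn : 0 ≤ᵐ[ν] fun t => (φ v).toReal - (φ (evalTime u t)).toReal -
      pairing (evalTime (p := p.conj) ξ t) (v - evalTime u t) := by
    -- The integral over `A` is the global subgradient inequality for the competitor `w` that is `v`
    -- on `A` and `u` elsewhere: off `A` the two sides cancel.
    refine ae_nonneg_of_forall_setIntegral_nonneg hg fun A hA _ => ?_
    classical
    obtain ⟨w, hw⟩ := exists_splice v hA u
    have hφw : (fun t => φ (evalTime w t)) =ᵐ[ν]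
        fun t => if t ∈ A then φ v else φ (evalTime u t) := by
      filter_upwards [hw] with t ht
      rw [ht]
      split_ifs <;> rfl
    have hwfin : timeIntegral ν φ w ≠ ∞ := by
      refine timeIntegral_ne_top_iff.2 ⟨(aemeasurable_ite_mem hA aemeasurable_const hu'.1).congr
        hφw.symm, ?_⟩
      rw [lintegral_congr_ae hφw]
      refine ne_top_of_le_ne_top (b := ∫⁻ t, (φ v + φ (evalTime u t)) ∂ν) ?_
        (lintegral_mono fun t => ?_)
      · rw [lintegral_add_left measurable_const, lintegral_const]
        exact ENNReal.add_ne_top.2 ⟨ENNReal.mul_ne_top hv (measure_ne_top ν _), hu'.2⟩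
      · split_ifs
        exacts [le_self_add, le_add_self]
    have hle := h w hwfin
    rw [pairing_sub, ← integral_pairing_evalTime, ← integral_pairing_evalTime,
      toReal_timeIntegral hu, toReal_timeIntegral hwfin,
      ← integral_sub (integrable_pairing_evalTime ξ w) (integrable_pairing_evalTime ξ u),
      ← integral_sub (integrable_toReal_of_timeIntegral_ne_top hwfin) hIu, ← sub_nonneg]
      at hle
    rw [← integral_indicator hA]
    refine (hle.trans_eq (integral_sub ((integrable_toReal_of_timeIntegral_ne_top hwfin).sub hIu)
      ((integrable_pairing_evalTime ξ w).sub (integrable_pairing_evalTime ξ u))).symm).trans_eq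
      (integral_congr_ae ?_)
    filter_upwards [hw] with t ht
    by_cases htA : t ∈ A <;> simp [ht, htA, pairing_sub]
  filter_upwards [hnn] with t ht
  exact sub_nonneg.1 ht

/-- A countable subset of the domain of `φ` is dense in it together with the values of `φ`. -/
lemma exists_countable_dense_graph {X : Type*} [PseudoMetricSpace X]
    [TopologicalSpace.SeparableSpace X] (φ : X → ℝ≥0∞) :
    ∃ D : Set X, D.Countable ∧ (∀ v ∈ D, φ v ≠ ∞) ∧ ∀ v, φ v ≠ ∞ →
      (v, (φ v).toReal) ∈ closure ((fun v => (v, (φ v).toReal)) '' D) := by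
  have : SecondCountableTopology X := UniformSpace.secondCountable_of_separable _
  -- Density is taken in the graph, inside `X × ℝ`: without continuity of `φ`, density in the domain
  -- would not approximate its values.
  obtain ⟨S, hS, hSc, hd⟩ := (TopologicalSpace.IsSeparable.of_separableSpace
    ((fun v => (v, (φ v).toReal)) '' {v | φ v ≠ ∞})).exists_countable_dense_subset
  obtain ⟨D, hD, hDc, hDS⟩ : ∃ D ⊆ {v | φ v ≠ ∞}, D.Countable ∧
      (fun v => (v, (φ v).toReal)) '' D = S := by
    obtain ⟨D, hD, rfl⟩ := subset_image_iff.1 hS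
    exact ⟨D, hD, countable_of_injective_of_countable_image
      (fun a _ b _ hab => congrArg Prod.fst hab) hSc, rfl⟩
  exact ⟨D, hDc, fun v hv => hD hv, fun v hv => hDS ▸ hd ⟨v, hv, rfl⟩⟩

/-- A subgradient of the time integral is a subgradient at almost every time. -/
lemma ae_mem_subdifferential_of_mem_subdifferential_timeIntegral
    [TopologicalSpace.SeparableSpace (VarLp p)] {u : VarLp (p.onProd ν)}
    {ξ : VarLp (p.onProd ν).conj} (h : ξ ∈ subdifferential (timeIntegral ν φ) u) :
    ∀ᵐ t ∂ν, evalTime (p := p.conj) ξ t ∈ subdifferential φ (evalTime u t) := by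
  obtain ⟨D, hD, hDfin, hdense⟩ := exists_countable_dense_graph φ
  have hall := (ae_ball_iff hD).2 fun v hv => ae_pairing_le_of_mem_subdifferential h (hDfin v hv)
  filter_upwards [hall, ae_ne_top_of_timeIntegral_ne_top h.1] with t ht hfin
  refine ⟨hfin, fun v hv => ?_⟩
  -- With the value of `φ` as an independent real coordinate, the inequality is a closed condition
  -- and passes from the points over `D` to the whole graph.
  have hclosed : IsClosed {z : VarLp p × ℝ | pairing (evalTime (p := p.conj) ξ t)
      (z.1 - evalTime u t) ≤ z.2 - (φ (evalTime u t)).toReal} :=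
    isClosed_le ((continuous_pairing _).comp (continuous_fst.sub continuous_const))
      (continuous_snd.sub continuous_const)
  refine closure_minimal ?_ hclosed (hdense v hv)
  rintro _ ⟨w, hw, rfl⟩
  exact ht w hw

end Subdifferential

end VarLp

theorem lemma3p2 {N : ℕ} (Ω : Set (EuclideanSpace ℝ (Fin N))) (hΩ : IsOpen Ω)
    (T : ℝ) (hT : 0 < T) (p : VarExponent (volume.restrict Ω))
    (φ : VarLp p → ℝ≥0∞) (hproper : ∃ v, φ v ≠ ∞) (hconv : ConvexOn ℝ≥0 univ φ)
    (hlsc : LowerSemicontinuous φ)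
    (u : VarLp (p.onProd (volume.restrict (Ioo 0 T))))
    (ξ : VarLp (p.onProd (volume.restrict (Ioo 0 T))).conj) :
    ξ ∈ VarLp.subdifferential (VarLp.timeIntegral (volume.restrict (Ioo 0 T)) φ) u ↔
      ∀ᵐ t ∂(volume.restrict (Ioo 0 T)),
        VarLp.evalTime (p := p.conj) ξ t ∈ VarLp.subdifferential φ (VarLp.evalTime u t) :=
  ⟨VarLp.ae_mem_subdifferential_of_mem_subdifferential_timeIntegral,
    VarLp.mem_subdifferential_timeIntegral hproper hlsc⟩
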